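/- **Proposition (spherical cross-correlation).** Let $S^2\subset\mathbb{R}^3$ be the unit sphere with its surface measure $dx$ (total mass $4\pi$), and let $dg$ be the Haar measure on $\mathbf{SO}(3)$ of total mass one. For $\ell\in\mathbb{N}$ and $-\ell\le m\le \ell$ let $$Y_m^\ell(\theta,\phi)=\sqrt{\tfrac{2\ell+1}{4\pi}\tfrac{(\ell-m)!}{(\ell+m)!}}\;P_m^\ell(\cos\theta)\,e^{im\phi},\qquad P_m^\ell(t)=\tfrac{(-1)^{\ell+m}}{2^\ell\,\ell!}(1-t^2)^{m/2}\tfrac{d^{\ell+m}}{dt^{\ell+m}}(1-t^2)^\ell ,$$ be the spherical harmonics. For $h\in L^2(S^2)$ let $\hat h^\ell\in\mathbb{C}^{2\ell+1}$ be the column vector with entries $\hat h^\ell_m=\int_{S^2}h(x)\overline{Y^\ell_m(x)}\,dx$. Let $\rho_\ell$ be the irreducible unitary representation of $\mathbf{SO}(3)$ on the spherical harmonics of degree $\ell$, written as a matrix in the basis $(Y^\ell_m)_m$: $\rho_\ell^{mn}(g)=\int_{S^2}Y^\ell_n(g^{-1}x)\overline{Y^\ell_m(x)}\,dx$, so that $Y^\ell(gx)=\overline{\rho_\ell(g)}\,Y^\ell(x)$.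 For $F\in L^2(\mathbf{SO}(3))$ and a unitary matrix representation $\rho$ let $\hat F(\rho)=\int_{\mathbf{SO}(3)}F(g)\rho(g)^*\,dg$; the coefficient matrix of $F$ at $\rho$ (the one that appears in the Fourier expansion $F(g)=\sum_{[\rho]}\operatorname{tr}\big(d_\rho\hat F(\rho)\,\rho(g)\big)$) is $d_\rho\hat F(\rho)$, where $d_\rho$ is the dimension of $\rho$. Let $f,k\in L^2(S^2)$ be complex-valued. Then for every $g\in\mathbf{SO}(3)$ the function $x\mapsto k(g^{-1}x)f(x)$ is integrable on $S^2$, and the spherical cross-correlation $$(f\star k)(g)=\int_{S^2}k(g^{-1}x)f(x)\,dx$$ is a function in $L^2(\mathbf{SO}(3))$. Its coefficient matrices are outer products of the vectors of spherical harmonic coefficients: if $k$ is real-valued (almost everywhere), then for every $\ell\in\mathbb{N}$ $$(2\ell+1)\,\widehat{(f\star k)}(\overline{\rho_\ell})=\overline{\hat k^\ell}\,(\hat f^\ell)^\top ,$$ and if $f$ is real-valued (almost everywhere), then for every $\ell\in\mathbb{N}$ $$(2\ell+1)\,\widehat{(f\star k)}(\rho_\ell)=\hat k^\ell\,\big(\overline{\hat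 f^\ell}\big)^\top .$$ In particular both formulas hold when $f$ and $k$ are real-valued. -/

import Mathlib

open MeasureTheory

open scoped ComplexConjugate Nat

noncomputable section

namespace SphericalCorrelation

/-- The unit sphere `S²` of Euclidean `ℝ³`. -/
abbrev S2 : Type := Metric.sphere (0 : EuclideanSpace ℝ (Fin 3)) 1

/-- Surface measure on `S²` (total mass `4π`). -/
def surfaceMeasure : Measure S2 :=
  (volume : Measure (EuclideanSpace ℝ (Fin 3))).toSphere

/-- The rotation group `SO(3)`: real `3 × 3` orthogonal matrices of determinant one. -/
abbrev SO3 : Type := Matrix.specialOrthogonalGroup (Fin 3) ℝ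

lemma SO3.transpose_mul_self (g : SO3) : (g : Matrix (Fin 3) (Fin 3) ℝ).transpose * g.1 = 1 := by
  have h := (Matrix.mem_orthogonalGroup_iff' (Fin 3) ℝ).1 (Matrix.mem_specialOrthogonalGroup_iff.1 g.2).1
  exact h

lemma SO3.coe_inv (g : SO3) : ((g⁻¹ : SO3) : Matrix (Fin 3) (Fin 3) ℝ) = g.1.transpose := rfl

instance : IsTopologicalGroup SO3 where
  continuous_mul := by
    refine Continuous.subtype_mk ?_ _
    exact (continuous_subtype_val.comp continuous_fst).mul
      (continuous_subtype_val.comp continuous_snd)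
  continuous_inv := by
    refine Continuous.subtype_mk ?_ _
    exact continuous_subtype_val.matrix_transpose

instance : CompactSpace SO3 := by
  refine isCompact_iff_compactSpace.1 ?_
  have hcl : IsClosed {A : Matrix (Fin 3) (Fin 3) ℝ | A.transpose * A = 1 ∧ A.det = 1} := by
    refine IsClosed.inter ?_ ?_
    · exact isClosed_eq (continuous_id.matrix_transpose.mul continuous_id) continuous_const
    · exact isClosed_eq continuous_id.matrix_det continuous_const
  have heq : (Matrix.specialOrthogonalGroup (Fin 3) ℝ : Set (Matrix (Fin 3) (Fin 3) ℝ))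
      = {A | A.transpose * A = 1 ∧ A.det = 1} := by
    ext A
    exact Matrix.mem_specialOrthogonalGroup_iff.trans
      (and_congr_left' (Matrix.mem_orthogonalGroup_iff' (Fin 3) ℝ))
  rw [heq]
  refine IsCompact.of_isClosed_subset
    (IsCompact.matrix (isCompact_Icc : IsCompact (Set.Icc (-1 : ℝ) 1))) hcl ?_
  rintro A ⟨hA, -⟩ i j
  have h : (A.transpose * A) j j = 1 := by rw [hA]; simp
  rw [Matrix.mul_apply] at h
  have h2 : A i j * A i j ≤ 1 := by
    rw [← h]
    exact Finset.single_le_sum (f := fun k => A.transpose j k * A k j)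
      (fun k _ => mul_self_nonneg (A k j)) (Finset.mem_univ i)
  exact abs_le.1 (abs_le_one_iff_mul_self_le_one.2 h2)

instance : MeasurableSpace SO3 := borel SO3

instance : BorelSpace SO3 := ⟨rfl⟩

/-- The Haar measure on `SO(3)`, normalized to total mass one. -/
def haarSO3 : Measure SO3 := Measure.haarMeasure ⊤

/-- The rotation action of `SO(3)` on `S²`: the matrix `g` applied to the column vector `x`. -/
def rotate (g : SO3) (x : S2) : S2 :=
  ⟨WithLp.toLp 2 (g.1.mulVec x.1.ofLp), by
    have hx : ‖(x : EuclideanSpace ℝ (Fin 3))‖ = 1 := norm_eq_of_mem_sphere x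
    have key : (WithLp.toLp 2 (g.1.mulVec x.1.ofLp) : EuclideanSpace ℝ (Fin 3)).ofLp ⬝ᵥ
        (WithLp.toLp 2 (g.1.mulVec x.1.ofLp) : EuclideanSpace ℝ (Fin 3)).ofLp
        = x.1.ofLp ⬝ᵥ x.1.ofLp := by
      change g.1.mulVec x.1.ofLp ⬝ᵥ g.1.mulVec x.1.ofLp = _
      rw [Matrix.dotProduct_mulVec, Matrix.vecMul_mulVec, SO3.transpose_mul_self,
        Matrix.vecMul_one]
    have hn : ∀ v : EuclideanSpace ℝ (Fin 3), ‖v‖ ^ 2 = v.ofLp ⬝ᵥ v.ofLp := by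
      intro v
      rw [EuclideanSpace.real_norm_sq_eq]
      simp [dotProduct, pow_two]
    rw [← hn, ← hn, hx] at key
    rw [mem_sphere_zero_iff_norm]
    nlinarith [norm_nonneg
      (WithLp.toLp 2 (g.1.mulVec x.1.ofLp) : EuclideanSpace ℝ (Fin 3))]⟩

/-- The orders `m = -ℓ, …, ℓ` of the spherical harmonics of degree `ℓ`. -/
abbrev Order (ℓ : ℕ) : Type := Set.Icc (-(ℓ : ℤ)) (ℓ : ℤ)

/-- Associated Legendre function
`P_m^ℓ(t) = (-1)^(ℓ+m) / (2^ℓ ℓ!) (1 - t²)^(m/2) (d/dt)^(ℓ+m) (1 - t²)^ℓ`, for `-ℓ ≤ m ≤ ℓ`. -/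
def assocLegendre (ℓ : ℕ) (m : Order ℓ) (t : ℝ) : ℝ :=
  (-1) ^ (ℓ + m.1).toNat / (2 ^ ℓ * (ℓ ! : ℝ)) * (1 - t ^ 2) ^ ((m.1 : ℝ) / 2) *
    iteratedDeriv (ℓ + m.1).toNat (fun s : ℝ => (1 - s ^ 2) ^ ℓ) t

/-- The spherical harmonic
`Y_m^ℓ(θ, φ) = √((2ℓ+1)/(4π) · (ℓ-m)!/(ℓ+m)!) P_m^ℓ(cos θ) e^{imφ}`
at a point `x = (sin θ cos φ, sin θ sin φ, cos θ)` of the sphere,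
so that `cos θ = x₂` and `φ` is the argument of `x₀ + i x₁`. -/
def sphericalHarmonic (ℓ : ℕ) (m : Order ℓ) (x : S2) : ℂ :=
  (Real.sqrt ((2 * ℓ + 1) / (4 * Real.pi) *
      (((ℓ - m.1).toNat ! : ℝ) / ((ℓ + m.1).toNat ! : ℝ))) : ℂ) *
    (assocLegendre ℓ m (x.1 2) : ℂ) *
    Complex.exp (Complex.I * (m.1 : ℂ) * (Complex.arg (⟨x.1 0, x.1 1⟩ : ℂ) : ℂ))

/-- Spherical harmonic coefficients `f̂_m^ℓ = ∫ f(x) conj(Y_m^ℓ(x)) dx`, as a vector in `m`. -/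
def sphCoeff (f : S2 → ℂ) (ℓ : ℕ) : Order ℓ → ℂ :=
  fun m => ∫ x, f x * conj (sphericalHarmonic ℓ m x) ∂surfaceMeasure

/-- The spherical cross-correlation `(f ⋆ k)(g) = ∫ k(g⁻¹ x) f(x) dx`. -/
def crossCorrelation (f k : S2 → ℂ) (g : SO3) : ℂ :=
  ∫ x, k (rotate g⁻¹ x) * f x ∂surfaceMeasure

/-- The irreducible unitary representation `ρ_ℓ` of `SO(3)` of dimension `2ℓ+1`, in matrix form:
its entries `ρ_ℓ^{mn}(g) = ⟨λ(g) Y_n^ℓ, Y_m^ℓ⟩` are the matrix elements of the rotation action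
`(λ(g) Y)(x) = Y(g⁻¹ x)` in the basis `Y_{-ℓ}^ℓ, …, Y_ℓ^ℓ` of the spherical harmonics of
degree `ℓ` (the Wigner D-matrix). -/
def wignerD (ℓ : ℕ) (g : SO3) : Matrix (Order ℓ) (Order ℓ) ℂ :=
  Matrix.of fun m n =>
    ∫ x, sphericalHarmonic ℓ n (rotate g⁻¹ x) * conj (sphericalHarmonic ℓ m x) ∂surfaceMeasure

/-- The complex conjugate of `ρ_ℓ`, for which `Y^ℓ(g x) = conj(ρ_ℓ(g)) Y^ℓ(x)`. -/
def wignerDConj (ℓ : ℕ) (g : SO3) : Matrix (Order ℓ) (Order ℓ) ℂ :=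
  (wignerD ℓ g).map conj

/-- The Fourier transform `F̂(ρ) = ∫ F(g) ρ(g)^* dg` of a function on `SO(3)`, at a
matrix representation `ρ`; the integral is taken entrywise. -/
def fourierSO3 {n : Type} (F : SO3 → ℂ) (ρ : SO3 → Matrix n n ℂ) : Matrix n n ℂ :=
  Matrix.of fun i j => ∫ g, F g * (ρ g).conjTranspose i j ∂haarSO3

end SphericalCorrelation

end

/-!
The key formula holds for all complex-valued `f, k ∈ L²(S²)`:
`(2ℓ+1) ∫ (f ⋆ k)(g) conj(ρ_ℓ^{mn}(g)) dg = k̂_n^ℓ ∫ f(x) Y_m^ℓ(x) dx`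
(`integral_crossCorrelation_mul_conj_wignerD`).
For real-valued `f` the last integral is the conjugate of `f̂_m^ℓ`; for real-valued `k` one
conjugates the formula for `conj f` and `k`.

By Fubini, the key formula follows once `A_m(x) = ∫ k(g⁻¹x) conj(ρ_ℓ^{mn}(g)) dg`, the function
`columnAverage`, is known to be `k̂_n^ℓ Y_m^ℓ(x) / (2ℓ+1)`. Left invariance of Haar measure gives
`A(hx) = conj(ρ_ℓ(h)) A(x)`, which is the transformation law of the vector `Y^ℓ`. Since `SO(3)`
acts transitively, it suffices to compare the two at the north pole. There the rotations about the
polar axis annihilate every component of order `m ≠ 0`, and for `m = 0` the entry `ρ_ℓ^{0n}(g)` is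
proportional to `Y_n^ℓ(g⁻¹x)`, so that the average over the group becomes the integral over the
sphere that defines `k̂_n^ℓ` (`integral_orbit`). Neither completeness of the spherical harmonics
nor the general Schur relations are needed.

This uses that the matrix `ρ_ℓ`, defined by integrals against the explicit `Y_m^ℓ`, is a unitary
representation that implements the rotation of `Y^ℓ`. The source of all these facts is the
generating function `sum_weight_mul_sphericalHarmonic`, which is Taylor's formula for
`(1 - s²)^ℓ`: it expands `(a · x)^ℓ` in the `Y_m^ℓ(x)` for the null vector
`a = (p² - q², -i(p² + q²), 2pq)` of a spinor `(p, q)`. Every null vector of `ℂ³` is of this form, rotations permute the null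
vectors, and in coordinates the hermitian product of two such powers is a constant times the
`ℓ`-th power of the hermitian product of the null vectors (`spinorCoeff_dotProduct_star`). Hence
rotations act on `Y^ℓ` by unitary matrices `U` (`exists_unitary_sphericalHarmonic`). The Gram
matrix of the `Y_m^ℓ` in `L²(S²)` is diagonal, commutes with the conjugates of these matrices,
whose row of order `0` has no entry that vanishes for all rotations, and so is scalar; its trace
is computed from the constancy of `∑ |Y_m^ℓ|²`; so the `Y_m^ℓ` are orthonormal (`gram_eq_one`),
and `U = ρ_ℓ`.
-/

namespace SphericalCorrelation

/-! ### Haar measure and surface measure -/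

instance : SecondCountableTopology SO3 :=
  have : SecondCountableTopology (Matrix (Fin 3) (Fin 3) ℝ) :=
    inferInstanceAs (SecondCountableTopology (Fin 3 → Fin 3 → ℝ))
  inferInstanceAs (SecondCountableTopology
    (Matrix.specialOrthogonalGroup (Fin 3) ℝ : Set (Matrix (Fin 3) (Fin 3) ℝ)))

instance : Measure.IsHaarMeasure haarSO3 :=
  inferInstanceAs (Measure.IsHaarMeasure (Measure.haarMeasure _))

instance : IsProbabilityMeasure haarSO3 :=
  ⟨by simpa using! Measure.haarMeasure_self (K₀ := (⊤ : TopologicalSpace.PositiveCompacts SO3))⟩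

/-- The right translates of the normalized Haar measure are normalized Haar measures, hence equal to
it. -/
instance : Measure.IsMulRightInvariant haarSO3 :=
  ⟨fun g => by
    have : IsProbabilityMeasure (haarSO3.map (· * g)) :=
      Measure.isProbabilityMeasure_map (measurable_mul_const g).aemeasurable
    exact Measure.isHaarMeasure_eq_of_isProbabilityMeasure _ _⟩

instance : IsFiniteMeasure surfaceMeasure :=
  inferInstanceAs (IsFiniteMeasure (Measure.toSphere _))

lemma surfaceMeasure_univ : surfaceMeasure Set.univ = ENNReal.ofReal (4 * Real.pi) := by
  rw [surfaceMeasure, Measure.toSphere_apply_univ, EuclideanSpace.volume_ball_fin_three]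
  rw [finrank_euclideanSpace_fin]
  rw [ENNReal.ofReal_one, one_pow, one_mul, ← ENNReal.ofReal_natCast,
    ← ENNReal.ofReal_mul (by norm_num)]
  congr 1
  push_cast
  ring

lemma surfaceMeasure_univ_ne_zero : surfaceMeasure Set.univ ≠ 0 := by
  rw [surfaceMeasure_univ]
  simpa using Real.pi_pos

/-! ### The rotation action on the sphere and its invariant measures -/

lemma rotate_apply (g : SO3) (x : S2) (i : Fin 3) :
    (rotate g x).1 i = ∑ j, g.1 i j * x.1 j := rfl

lemma rotate_mul (g h : SO3) (x : S2) : rotate (g * h) x = rotate g (rotate h x) := by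
  apply Subtype.ext
  simp [rotate, Matrix.mulVec_mulVec]

lemma rotate_one (x : S2) : rotate 1 x = x := by
  apply Subtype.ext
  simp [rotate]

lemma rotate_inv_rotate (g : SO3) (x : S2) : rotate g⁻¹ (rotate g x) = x := by
  rw [← rotate_mul, inv_mul_cancel, rotate_one]

lemma rotate_rotate_inv (g : SO3) (x : S2) : rotate g (rotate g⁻¹ x) = x := by
  rw [← rotate_mul, mul_inv_cancel, rotate_one]

lemma continuous_rotate_uncurry : Continuous fun p : SO3 × S2 => rotate p.1 p.2 := by
  refine Continuous.subtype_mk ?_ _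
  refine (PiLp.continuous_toLp 2 _).comp (Continuous.matrix_mulVec ?_ ?_)
  · exact continuous_subtype_val.comp continuous_fst
  · exact (PiLp.continuous_ofLp 2 _).comp (continuous_subtype_val.comp continuous_snd)

@[fun_prop]
lemma Continuous.rotate {X : Type*} [TopologicalSpace X] {u : X → SO3} {v : X → S2}
    (hu : Continuous u) (hv : Continuous v) : Continuous fun x => rotate (u x) (v x) :=
  continuous_rotate_uncurry.comp (hu.prodMk hv)

/-- The linear isometry of `ℝ³` given by a rotation. -/
noncomputable def rotateLinear (g : SO3) :
    EuclideanSpace ℝ (Fin 3) ≃ₗᵢ[ℝ] EuclideanSpace ℝ (Fin 3) :=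
  LinearIsometry.toLinearIsometryEquiv
    { toLinearMap := Matrix.toEuclideanLin g.1
      norm_map' := fun v => by
        have hn : ∀ v : EuclideanSpace ℝ (Fin 3), ‖v‖ ^ 2 = v.ofLp ⬝ᵥ v.ofLp := by
          intro v
          rw [EuclideanSpace.real_norm_sq_eq]
          simp [dotProduct, pow_two]
        rw [← sq_eq_sq₀ (norm_nonneg _) (norm_nonneg _), hn, hn]
        change g.1.mulVec v.ofLp ⬝ᵥ g.1.mulVec v.ofLp = _
        rw [Matrix.dotProduct_mulVec, Matrix.vecMul_mulVec, SO3.transpose_mul_self,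
          Matrix.vecMul_one] } rfl

lemma coe_rotate (g : SO3) (x : S2) : (rotate g x).1 = rotateLinear g x.1 := rfl

open scoped Pointwise in
/-- The surface measure of a set is read off from the volume of the cone over it, which a rotation
preserves. -/
lemma measurePreserving_rotate (g : SO3) :
    MeasurePreserving (rotate g) surfaceMeasure surfaceMeasure := by
  have hm : Measurable (rotate g) := (Continuous.rotate continuous_const continuous_id).measurable
  refine ⟨hm, ?_⟩
  ext s hs
  rw [Measure.map_apply hm hs, surfaceMeasure, Measure.toSphere_apply' _ (hm hs),
    Measure.toSphere_apply' _ hs]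
  congr 1
  rw [← ((rotateLinear g).measurePreserving).measure_preimage_emb
    (rotateLinear g).toHomeomorph.measurableEmbedding
      (Set.Ioo (0 : ℝ) 1 • ((↑) '' s : Set (EuclideanSpace ℝ (Fin 3))))]
  congr 1
  ext v
  simp only [Set.mem_smul, Set.mem_image, Set.mem_preimage]
  constructor
  · rintro ⟨c, hc, _, ⟨x, hx, rfl⟩, rfl⟩
    exact ⟨c, hc, _, ⟨_, hx, rfl⟩, by rw [coe_rotate, map_smul]⟩
  · rintro ⟨c, hc, _, ⟨x, hx, rfl⟩, h⟩
    refine ⟨c, hc, _, ⟨rotate g⁻¹ x, ?_, rfl⟩, ?_⟩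
    · rwa [rotate_rotate_inv]
    · apply (rotateLinear g).injective
      rw [← h, map_smul, ← coe_rotate, rotate_rotate_inv]

/-- The north pole `(0, 0, 1)`. -/
def northPole : S2 := ⟨!₂[0, 0, 1], by simp [EuclideanSpace.norm_eq, Fin.sum_univ_three]⟩

lemma sum_sq_eq_one (x : S2) : x.1 0 ^ 2 + x.1 1 ^ 2 + x.1 2 ^ 2 = 1 := by
  have hx : ‖x.1‖ = 1 := norm_eq_of_mem_sphere x
  have := EuclideanSpace.real_norm_sq_eq x.1
  rw [hx, Fin.sum_univ_three] at this
  linarith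

/-- The rotation by the angle `α` about the polar axis. -/
noncomputable def polarRotation (α : ℝ) : SO3 :=
  ⟨!![Real.cos α, -Real.sin α, 0; Real.sin α, Real.cos α, 0; 0, 0, 1], by
    have h := Real.sin_sq_add_cos_sq α
    rw [Matrix.mem_specialOrthogonalGroup_iff, Matrix.mem_orthogonalGroup_iff]
    constructor
    · ext i j
      fin_cases i <;> fin_cases j <;> simp [Matrix.mul_apply, Fin.sum_univ_three] <;>
        first | ring1 | linear_combination h
    · simp [Matrix.det_fin_three]
      linear_combination h⟩

lemma rotate_polarRotation_northPole (α : ℝ) : rotate (polarRotation α) northPole = northPole := by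
  apply Subtype.ext
  ext i
  rw [rotate_apply]
  fin_cases i <;> simp [polarRotation, northPole, Fin.sum_univ_three]

/-- A point with spherical coordinates `(θ, φ)` is the image of the pole under the rotation by `θ`
about the second axis followed by the rotation by `φ` about the polar axis. -/
lemma exists_rotate_northPole_eq (x : S2) : ∃ g : SO3, rotate g northPole = x := by
  set z : ℂ := ⟨x.1 0, x.1 1⟩
  set c := Real.cos z.arg
  set s := Real.sin z.arg
  set r := ‖z‖
  set t := x.1 2
  have h : s ^ 2 + c ^ 2 = 1 := Real.sin_sq_add_cos_sq _
  have h0 : r * c = x.1 0 := Complex.norm_mul_cos_arg z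
  have h1 : r * s = x.1 1 := Complex.norm_mul_sin_arg z
  have h2 : r ^ 2 + t ^ 2 = 1 := by
    have := sum_sq_eq_one x
    rw [← h0, ← h1] at this
    linear_combination this - r ^ 2 * h
  refine ⟨⟨!![c * t, -s, c * r; s * t, c, s * r; -r, 0, t], ?_⟩, ?_⟩
  · rw [Matrix.mem_specialOrthogonalGroup_iff, Matrix.mem_orthogonalGroup_iff']
    constructor
    · ext i j
      fin_cases i <;> fin_cases j <;>
        simp [Matrix.mul_apply, Fin.sum_univ_three]
      · linear_combination t ^ 2 * h + h2
      · ring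
      · linear_combination r * t * h
      · ring
      · linear_combination h
      · ring
      · linear_combination r * t * h
      · ring
      · linear_combination r ^ 2 * h + h2
    · simp [Matrix.det_fin_three]
      linear_combination h2 * (s ^ 2 + c ^ 2) + h
  · apply Subtype.ext
    ext i
    rw [rotate_apply]
    fin_cases i <;> simp [northPole, Fin.sum_univ_three]
    · rw [← h0, mul_comm]
    · rw [← h1, mul_comm]
    · rfl

lemma exists_rotate_eq (x y : S2) : ∃ g : SO3, rotate g x = y := by
  obtain ⟨g, rfl⟩ := exists_rotate_northPole_eq x
  obtain ⟨h, rfl⟩ := exists_rotate_northPole_eq y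
  exact ⟨h * g⁻¹, by rw [rotate_mul, rotate_inv_rotate]⟩

/-- The orbit map of a point carries Haar measure to the uniform distribution on the sphere:
average the measure of a set over all its rotations and exchange the two integrals. -/
lemma map_orbit_haarSO3 (x : S2) :
    haarSO3.map (fun g => rotate g⁻¹ x) = (surfaceMeasure Set.univ)⁻¹ • surfaceMeasure := by
  have hm (x : S2) : Measurable (fun g : SO3 => rotate g⁻¹ x) :=
    Continuous.measurable (by fun_prop)
  ext s hs
  have hpre : MeasurableSet {p : SO3 × S2 | rotate p.1⁻¹ p.2 ∈ s} :=
    (show Continuous fun p : SO3 × S2 => rotate p.1⁻¹ p.2 by fun_prop).measurable hs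
  -- the Haar measure of `{g | g⁻¹ y ∈ s}` does not depend on `y`
  have hconst (y : S2) : haarSO3 {g | rotate g⁻¹ y ∈ s} = haarSO3 {g | rotate g⁻¹ x ∈ s} := by
    obtain ⟨h, rfl⟩ := exists_rotate_eq x y
    rw [← measure_preimage_mul haarSO3 h]
    simp only [Set.preimage_ofPred_eq, mul_inv_rev, rotate_mul, rotate_inv_rotate]
  have h1 : (haarSO3.prod surfaceMeasure) {p : SO3 × S2 | rotate p.1⁻¹ p.2 ∈ s}
      = surfaceMeasure s := by
    rw [Measure.prod_apply hpre]
    have (g : SO3) : surfaceMeasure (Prod.mk g ⁻¹' {p : SO3 × S2 | rotate p.1⁻¹ p.2 ∈ s})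
        = surfaceMeasure s := (measurePreserving_rotate g⁻¹).measure_preimage hs.nullMeasurableSet
    rw [lintegral_congr this, lintegral_const, measure_univ, mul_one]
  have h2 : (haarSO3.prod surfaceMeasure) {p : SO3 × S2 | rotate p.1⁻¹ p.2 ∈ s}
      = haarSO3 {g | rotate g⁻¹ x ∈ s} * surfaceMeasure Set.univ := by
    rw [Measure.prod_apply_symm hpre, ← lintegral_const]
    exact lintegral_congr fun y => hconst y
  rw [Measure.map_apply (hm x) hs, Measure.smul_apply, smul_eq_mul, ← h1, h2, mul_comm,
    mul_assoc, ENNReal.mul_inv_cancel surfaceMeasure_univ_ne_zero (measure_ne_top _ _), mul_one]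
  rfl

lemma integrable_orbit {h : S2 → ℂ} (hh : Integrable h surfaceMeasure) (x : S2) :
    Integrable (fun g => h (rotate g⁻¹ x)) haarSO3 := by
  have hm : Measurable (fun g : SO3 => rotate g⁻¹ x) := Continuous.measurable (by fun_prop)
  refine Integrable.comp_measurable (g := h) (f := fun g : SO3 => rotate g⁻¹ x) ?_ hm
  rw [map_orbit_haarSO3]
  exact hh.smul_measure (ENNReal.inv_ne_top.2 surfaceMeasure_univ_ne_zero)

lemma integral_orbit {h : S2 → ℂ} (hh : Integrable h surfaceMeasure) (x : S2) :
    ∫ g, h (rotate g⁻¹ x) ∂haarSO3 = (4 * Real.pi : ℂ)⁻¹ * ∫ y, h y ∂surfaceMeasure := by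
  have hm : Measurable (fun g : SO3 => rotate g⁻¹ x) := Continuous.measurable (by fun_prop)
  have hsm : AEStronglyMeasurable h (haarSO3.map fun g : SO3 => rotate g⁻¹ x) := by
    rw [map_orbit_haarSO3]
    exact hh.aestronglyMeasurable.smul_measure _
  rw [← integral_map hm.aemeasurable hsm, map_orbit_haarSO3, integral_smul_measure,
    surfaceMeasure_univ, ENNReal.toReal_inv, ENNReal.toReal_ofReal (by positivity),
    Complex.real_smul]
  push_cast
  rfl

lemma integral_rotate {E : Type*} [NormedAddCommGroup E] [NormedSpace ℝ E] (g : SO3) (h : S2 → E) :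
    ∫ x, h (rotate g x) ∂surfaceMeasure = ∫ x, h x ∂surfaceMeasure := by
  refine (measurePreserving_rotate g).integral_comp ?_ h
  exact (Homeomorph.measurableEmbedding
    { toFun := rotate g
      invFun := rotate g⁻¹
      left_inv := rotate_inv_rotate g
      right_inv := rotate_rotate_inv g
      continuous_toFun := by fun_prop
      continuous_invFun := by fun_prop })

/-! ### The generating function of the spherical harmonics -/

open Polynomial in
lemma iteratedDeriv_polynomial_eval (P : ℝ[X]) (k : ℕ) (t : ℝ) :
    iteratedDeriv k (fun s => P.eval s) t = k ! * (taylor t P).coeff k := by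
  have h (k : ℕ) : iteratedDeriv k (fun s => P.eval s) = fun s => (derivative^[k] P).eval s := by
    induction k with
    | zero => simp
    | succ k ih =>
      rw [iteratedDeriv_succ, ih, Function.iterate_succ_apply']
      ext s
      exact Polynomial.deriv _
  rw [h, taylor_coeff, ← factorial_smul_hasseDeriv]
  simp

open Polynomial in
/-- The Taylor coefficients at `t` of the polynomial `(1 - s²)^ℓ`. -/
noncomputable def rodriguesCoeff (ℓ : ℕ) (t : ℝ) (k : ℕ) : ℝ :=
  (taylor t ((1 - X ^ 2) ^ ℓ : ℝ[X])).coeff k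

lemma iteratedDeriv_one_sub_sq_pow (ℓ k : ℕ) (t : ℝ) :
    iteratedDeriv k (fun s : ℝ => (1 - s ^ 2) ^ ℓ) t = k ! * rodriguesCoeff ℓ t k := by
  rw [rodriguesCoeff, ← iteratedDeriv_polynomial_eval]
  simp

open Polynomial in
lemma taylor_one_sub_sq_pow (ℓ : ℕ) (t : ℝ) :
    taylor t ((1 - X ^ 2) ^ ℓ : ℝ[X]) = (C (1 - t ^ 2) - C (2 * t) * X - X ^ 2) ^ ℓ := by
  rw [taylor_pow]
  congr 1
  simp only [map_sub, taylor_one, taylor_X_pow, C_mul, C_pow, C_1, map_ofNat]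
  ring

/-- Taylor's formula for `(1 - s²)^ℓ`, made homogeneous in the pair `(p, h)`. -/
lemma sum_rodriguesCoeff (ℓ : ℕ) (t : ℝ) (p h : ℂ) :
    ∑ k ∈ Finset.range (2 * ℓ + 1), p ^ (2 * ℓ - k) * h ^ k * (rodriguesCoeff ℓ t k : ℂ) =
      (p ^ 2 * (1 - t ^ 2) - 2 * t * p * h - h ^ 2) ^ ℓ := by
  -- both sides are continuous in `p`, so that `p` may be taken nonzero
  revert p
  refine congrFun (Continuous.ext_on (dense_compl_singleton (0 : ℂ)) (by fun_prop) (by fun_prop) ?_)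
  intro p hp
  replace hp : p ≠ 0 := hp
  have hdeg : (Polynomial.taylor t ((1 - Polynomial.X ^ 2) ^ ℓ : Polynomial ℝ)).natDegree
      < 2 * ℓ + 1 := by
    rw [Polynomial.natDegree_taylor, Nat.lt_succ_iff, mul_comm]
    refine Polynomial.natDegree_pow_le_of_le ℓ ?_
    compute_degree
  have key := Polynomial.aeval_eq_sum_range' hdeg (h / p)
  have hL : Polynomial.aeval (h / p)
      (Polynomial.taylor t ((1 - Polynomial.X ^ 2) ^ ℓ : Polynomial ℝ)) =
      (((1 - t ^ 2 : ℝ) : ℂ) - ((2 * t : ℝ) : ℂ) * (h / p) - (h / p) ^ 2) ^ ℓ := by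
    rw [taylor_one_sub_sq_pow, map_pow, map_sub, map_sub, map_mul, Polynomial.aeval_C,
      Polynomial.aeval_C, map_pow, Polynomial.aeval_X]
    rfl
  rw [hL] at key
  have hp2 : p ^ (2 * ℓ) = (p ^ 2) ^ ℓ := pow_mul _ _ _
  have : (p ^ 2 * (1 - t ^ 2) - 2 * t * p * h - h ^ 2) ^ ℓ =
      p ^ (2 * ℓ) * (((1 - t ^ 2 : ℝ) : ℂ) - ((2 * t : ℝ) : ℂ) * (h / p) - (h / p) ^ 2) ^ ℓ := by
    rw [hp2, ← mul_pow]
    congr 1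
    push_cast
    field_simp
  simp only
  rw [this, key, Finset.mul_sum]
  refine Finset.sum_congr rfl fun k hk => ?_
  have hk' : k ≤ 2 * ℓ := Nat.lt_succ_iff.1 (Finset.mem_range.1 hk)
  rw [Complex.real_smul, div_pow, rodriguesCoeff]
  rw [show p ^ (2 * ℓ) = p ^ (2 * ℓ - k) * p ^ k by rw [← pow_add, Nat.sub_add_cancel hk']]
  field_simp

open Polynomial in
/-- At the poles `t = ±1` the polynomial `(1 - s²)^ℓ` vanishes to the exact order `ℓ`. -/
lemma rodriguesCoeff_self_of_sq_eq_one (ℓ : ℕ) {t : ℝ} (ht : 1 - t ^ 2 = 0) :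
    rodriguesCoeff ℓ t ℓ = (-2 * t) ^ ℓ := by
  have h : (C (1 - t ^ 2) - C (2 * t) * X - X ^ 2 : ℝ[X]) = X * (-C (2 * t) - X) := by
    rw [ht, C_0]; ring
  rw [rodriguesCoeff, taylor_one_sub_sq_pow, h, mul_pow, coeff_X_pow_mul', if_pos le_rfl,
    Nat.sub_self, coeff_zero_eq_eval_zero]
  simp

/-- The position `ℓ + m ∈ {0, …, 2ℓ}` of the order `m`. -/
def Order.index {ℓ : ℕ} (m : Order ℓ) : ℕ := (ℓ + m.1).toNat

lemma Order.index_le {ℓ : ℕ} (m : Order ℓ) : m.index ≤ 2 * ℓ := by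
  have := m.2.1; have := m.2.2; unfold Order.index; omega

lemma Order.coe_index {ℓ : ℕ} (m : Order ℓ) : (m.index : ℤ) = ℓ + m.1 := by
  have := m.2.1; unfold Order.index; omega

lemma Order.toNat_sub {ℓ : ℕ} (m : Order ℓ) : (ℓ - m.1).toNat = 2 * ℓ - m.index := by
  have := m.2.1; have := m.2.2; unfold Order.index; omega

/-- Orders are numbered by `0, …, 2ℓ`. -/
def orderEquiv (ℓ : ℕ) : Order ℓ ≃ Fin (2 * ℓ + 1) where
  toFun m := ⟨m.index, Nat.lt_succ_iff.2 m.index_le⟩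
  invFun k := ⟨(k : ℤ) - ℓ, by constructor <;> omega⟩
  left_inv m := by
    apply Subtype.ext
    have := m.coe_index
    simp only
    omega
  right_inv k := by
    apply Fin.ext
    simp [Order.index]

lemma sum_order_index {M : Type*} [AddCommMonoid M] (ℓ : ℕ) (F : ℕ → M) :
    ∑ m : Order ℓ, F m.index = ∑ k ∈ Finset.range (2 * ℓ + 1), F k := by
  rw [Finset.sum_range]
  exact Fintype.sum_equiv (orderEquiv ℓ) _ _ fun m => rfl

/-- The order `m = 0`. -/
def Order.zero (ℓ : ℕ) : Order ℓ := ⟨0, by constructor <;> omega⟩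

lemma Order.index_zero (ℓ : ℕ) : (Order.zero ℓ).index = ℓ := by simp [Order.zero, Order.index]

/-- The weight `2^ℓ ℓ! / √((2ℓ+1)/(4π) (ℓ-m)! (ℓ+m)!)` of `Y_m^ℓ` in the generating function;
the differences and sums are written through the index, `ℓ - m = 2ℓ - (ℓ + m)`. -/
noncomputable def weight (ℓ : ℕ) (m : Order ℓ) : ℝ :=
  2 ^ ℓ * ℓ ! / √((2 * ℓ + 1) / (4 * Real.pi) * ((2 * ℓ - m.index)! * (m.index)!))

lemma weight_pos (ℓ : ℕ) (m : Order ℓ) : 0 < weight ℓ m := by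
  unfold weight
  positivity

/-- Up to a common factor, the squared weights are the binomial coefficients. -/
lemma weight_sq (ℓ : ℕ) (m : Order ℓ) :
    weight ℓ m ^ 2 =
      (2 ^ ℓ * ℓ !) ^ 2 * (4 * Real.pi) / ((2 * ℓ + 1) * (2 * ℓ)!) * (2 * ℓ).choose m.index := by
  unfold weight
  rw [div_pow, Real.sq_sqrt (by positivity), Nat.cast_choose ℝ m.index_le]
  field_simp

/-- With the weight, the factorials and the normalizing square root of `Y_m^ℓ` disappear. -/
lemma weight_mul_sphericalHarmonic (ℓ : ℕ) (m : Order ℓ) (x : S2) :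
    (weight ℓ m : ℂ) * sphericalHarmonic ℓ m x =
      (-1) ^ m.index * (rodriguesCoeff ℓ (x.1 2) m.index : ℂ) *
        (((1 - x.1 2 ^ 2) ^ ((m.1 : ℝ) / 2) : ℝ) *
          Complex.exp (Complex.I * (m.1 : ℂ) * (Complex.arg (⟨x.1 0, x.1 1⟩ : ℂ) : ℂ))) := by
  have h : weight ℓ m * √((2 * ℓ + 1) / (4 * Real.pi) *
      (((2 * ℓ - m.index)! : ℝ) / ((m.index)! : ℝ))) = 2 ^ ℓ * ℓ ! / (m.index)! := by
    have : (2 * ℓ + 1) / (4 * Real.pi) * (((2 * ℓ - m.index)! : ℝ) / ((m.index)! : ℝ)) =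
        ((2 * ℓ + 1) / (4 * Real.pi) * ((2 * ℓ - m.index)! * (m.index)!)) /
          ((m.index)! : ℝ) ^ 2 := by
      field_simp
    rw [this, Real.sqrt_div (by positivity), Real.sqrt_sq (by positivity), weight]
    have : √((2 * ℓ + 1) / (4 * Real.pi) * ((2 * ℓ - m.index)! * (m.index)!)) ≠ 0 := by
      positivity
    field_simp
  have h' : (weight ℓ m : ℂ) * (Real.sqrt ((2 * ℓ + 1) / (4 * Real.pi) *
      (((2 * ℓ - m.index)! : ℝ) / ((m.index)! : ℝ))) : ℂ) = 2 ^ ℓ * ℓ ! / (m.index)! := by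
    rw [← Complex.ofReal_mul, h]
    push_cast
    rfl
  rw [sphericalHarmonic, m.toNat_sub, ← mul_assoc, ← mul_assoc]
  change _ * (Real.sqrt ((2 * ℓ + 1) / (4 * Real.pi) *
      (((2 * ℓ - m.index)! : ℝ) / ((m.index)! : ℝ))) : ℂ) * _ * _ = _
  rw [h', assocLegendre, iteratedDeriv_one_sub_sq_pow]
  change _ * (((-1) ^ m.index / (2 ^ ℓ * (ℓ ! : ℝ)) * _ *
    ((m.index)! * rodriguesCoeff ℓ (x.1 2) m.index) : ℝ) : ℂ) * _ = _
  push_cast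
  have h1 : (ℓ ! : ℂ) ≠ 0 := by exact_mod_cast (Nat.factorial_pos ℓ).ne'
  have h2 : ((m.index)! : ℂ) ≠ 0 := by exact_mod_cast (Nat.factorial_pos _).ne'
  field_simp

/-- The generating function of the spherical harmonics of degree `ℓ`. Away from the poles, where
`z = x₀ + i x₁` is nonzero, the right-hand side is `z ^ (-ℓ)` times the homogenized Taylor expansion
of `(1 - s²)^ℓ` at `x₂` with increment `-q z`. -/
theorem sum_weight_mul_sphericalHarmonic (ℓ : ℕ) (x : S2) (p q : ℂ) :
    ∑ m : Order ℓ, sphericalHarmonic ℓ m x *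
        (weight ℓ m * (p ^ (2 * ℓ - m.index) * q ^ m.index)) =
      ((p ^ 2 - q ^ 2) * x.1 0 - Complex.I * (p ^ 2 + q ^ 2) * x.1 1 + 2 * p * q * x.1 2) ^ ℓ := by
  set z : ℂ := ⟨x.1 0, x.1 1⟩ with hz
  set t : ℝ := x.1 2 with ht
  have hzI : z = x.1 0 + Complex.I * x.1 1 := by rw [mul_comm]; exact Complex.mk_eq_add_mul_I _ _
  have hnorm : 1 - t ^ 2 = ‖z‖ ^ 2 := by
    rw [Complex.sq_norm, Complex.normSq_apply]
    linear_combination -(sum_sq_eq_one x)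
  have hnormC : (1 - t ^ 2 : ℂ) = (x.1 0 - Complex.I * x.1 1) * z := by
    have := congrArg (Complex.ofReal) (sum_sq_eq_one x)
    push_cast at this
    rw [hzI]
    linear_combination -this + (x.1 1 : ℂ) ^ 2 * Complex.I_sq
  have hterm (m : Order ℓ) : sphericalHarmonic ℓ m x *
        (weight ℓ m * (p ^ (2 * ℓ - m.index) * q ^ m.index)) =
      p ^ (2 * ℓ - m.index) * (-q) ^ m.index * (rodriguesCoeff ℓ t m.index : ℂ) *
        (((1 - t ^ 2) ^ ((m.1 : ℝ) / 2) : ℝ) *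
          Complex.exp (Complex.I * (m.1 : ℂ) * (z.arg : ℂ))) := by
    have := weight_mul_sphericalHarmonic ℓ m x
    rw [neg_pow q]
    linear_combination (p ^ (2 * ℓ - m.index) * q ^ m.index) * this
  simp_rw [hterm]
  by_cases h0 : z = 0
  · -- at a pole only the order `m = 0` contributes
    have ht1 : 1 - t ^ 2 = 0 := by rw [hnorm, h0]; simp
    have hx0 : x.1 0 = 0 := congrArg Complex.re h0
    have hx1 : x.1 1 = 0 := congrArg Complex.im h0
    rw [Finset.sum_eq_single (Order.zero ℓ)]
    · rw [Order.index_zero, rodriguesCoeff_self_of_sq_eq_one ℓ ht1, hx0, hx1,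
        show 2 * ℓ - ℓ = ℓ by omega]
      simp only [Order.zero, Int.cast_zero, zero_div, Real.rpow_zero, mul_zero, zero_mul,
        Complex.exp_zero]
      push_cast
      rw [← mul_pow, ← mul_pow]
      ring
    · intro m _ hm
      have : (m.1 : ℝ) ≠ 0 := by
        rw [Int.cast_ne_zero]
        exact fun h => hm (Subtype.ext h)
      rw [ht1, Real.zero_rpow (div_ne_zero this two_ne_zero)]
      simp
    · simp
  · have hpow (m : Order ℓ) : (((1 - t ^ 2) ^ ((m.1 : ℝ) / 2) : ℝ) *
        Complex.exp (Complex.I * (m.1 : ℂ) * (z.arg : ℂ)) : ℂ) = z ^ m.index / z ^ ℓ := by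
      have hr : (1 - t ^ 2) ^ ((m.1 : ℝ) / 2) = ‖z‖ ^ m.1 := by
        rw [hnorm, ← Real.rpow_natCast, ← Real.rpow_mul (norm_nonneg _), ← Real.rpow_intCast]
        congr 1
        push_cast
        ring
      have he : Complex.exp (Complex.I * (m.1 : ℂ) * (z.arg : ℂ)) =
          Complex.exp (z.arg * Complex.I) ^ m.1 := by
        rw [← Complex.exp_int_mul]
        congr 1
        ring
      rw [hr, he, Complex.ofReal_zpow, ← mul_zpow, Complex.norm_mul_exp_arg_mul_I,
        ← zpow_natCast, ← zpow_natCast, ← zpow_sub₀ h0, m.coe_index]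
      congr 1
      ring
    have hsum := sum_rodriguesCoeff ℓ t p (-q * z)
    rw [← sum_order_index ℓ fun k => p ^ (2 * ℓ - k) * (-q * z) ^ k * (rodriguesCoeff ℓ t k : ℂ)]
      at hsum
    have hz' : z ^ ℓ ≠ 0 := pow_ne_zero _ h0
    rw [← mul_left_inj' hz', ← mul_pow, Finset.sum_mul]
    calc _ = ∑ m : Order ℓ, p ^ (2 * ℓ - m.index) * (-q * z) ^ m.index *
            (rodriguesCoeff ℓ t m.index : ℂ) := by
          refine Finset.sum_congr rfl fun m _ => ?_
          rw [hpow, mul_pow]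
          field_simp
      _ = _ := by
          rw [hsum]
          congr 1
          rw [hnormC, hzI]
          ring

/-! ### Null vectors and the unitary action of rotations -/

open Matrix

/-- The coordinates of a point of the sphere, as a complex vector. -/
def complexCoord (x : S2) : Fin 3 → ℂ := fun i => (x.1 i : ℂ)

/-- A rotation as a complex matrix. -/
def complexMatrix (g : SO3) : Matrix (Fin 3) (Fin 3) ℂ := g.1.map (fun r : ℝ => (r : ℂ))

lemma complexMatrix_transpose_mul_self (g : SO3) :
    (complexMatrix g)ᵀ * complexMatrix g = 1 := by
  have h : (g.1ᵀ * g.1).map Complex.ofRealHom = (1 : Matrix (Fin 3) (Fin 3) ℝ).map _ :=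
    congrArg (fun M => M.map Complex.ofRealHom) (SO3.transpose_mul_self g)
  rw [Matrix.map_mul, Matrix.map_one _ (map_zero _) (map_one _)] at h
  exact h

lemma complexMatrix_mulVec_dotProduct (g : SO3) (a b : Fin 3 → ℂ) :
    complexMatrix g *ᵥ a ⬝ᵥ complexMatrix g *ᵥ b = a ⬝ᵥ b := by
  rw [dotProduct_mulVec, vecMul_mulVec, complexMatrix_transpose_mul_self, vecMul_one]

lemma star_complexMatrix_mulVec (g : SO3) (a : Fin 3 → ℂ) :
    star (complexMatrix g *ᵥ a) = complexMatrix g *ᵥ star a := by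
  ext i
  simp [complexMatrix, mulVec, dotProduct]

lemma dotProduct_complexCoord_rotate_inv (g : SO3) (a : Fin 3 → ℂ) (x : S2) :
    a ⬝ᵥ complexCoord (rotate g⁻¹ x) = complexMatrix g *ᵥ a ⬝ᵥ complexCoord x := by
  have : complexCoord (rotate g⁻¹ x) = complexCoord x ᵥ* complexMatrix g := by
    ext i
    simp [complexCoord, rotate_apply, SO3.coe_inv, vecMul, dotProduct, complexMatrix, mul_comm]
  rw [this, dotProduct_comm, dotProduct_comm _ (complexCoord x), dotProduct_mulVec]

/-- The null vector of `ℂ³` attached to the spinor `(p, q)`. -/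
def nullVector (p q : ℂ) : Fin 3 → ℂ := ![p ^ 2 - q ^ 2, -Complex.I * (p ^ 2 + q ^ 2), 2 * p * q]

lemma nullVector_dotProduct_self (p q : ℂ) : nullVector p q ⬝ᵥ nullVector p q = 0 := by
  simp only [nullVector, dotProduct, Fin.sum_univ_three, cons_val]
  linear_combination (p ^ 2 + q ^ 2) ^ 2 * Complex.I_sq

/-- Every null vector of `ℂ³` comes from a spinor. -/
lemma exists_nullVector_eq {b : Fin 3 → ℂ} (hb : b ⬝ᵥ b = 0) : ∃ p q, nullVector p q = b := by
  rw [dotProduct, Fin.sum_univ_three] at hb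
  obtain ⟨p, hp⟩ := IsAlgClosed.exists_pow_nat_eq ((b 0 + Complex.I * b 1) / 2) two_pos
  obtain ⟨q, hq⟩ := IsAlgClosed.exists_pow_nat_eq ((-b 0 + Complex.I * b 1) / 2) two_pos
  have hpq : (2 * p * q) ^ 2 = b 2 ^ 2 := by
    rw [mul_pow, mul_pow, hp, hq]
    linear_combination -hb + b 1 ^ 2 * Complex.I_sq
  have key (q : ℂ) (hq : q ^ 2 = (-b 0 + Complex.I * b 1) / 2) (h2 : 2 * p * q = b 2) :
      nullVector p q = b := by
    ext i
    fin_cases i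
    · change p ^ 2 - q ^ 2 = b 0
      rw [hp, hq]; ring
    · change -Complex.I * (p ^ 2 + q ^ 2) = b 1
      rw [hp, hq]
      linear_combination -(b 1) * Complex.I_sq
    · exact h2
  -- `p` and `q` are found from their squares, up to the sign of `2pq`
  rcases sq_eq_sq_iff_eq_or_eq_neg.1 hpq with h | h
  · exact ⟨p, q, key q hq h⟩
  · exact ⟨p, -q, key (-q) (by rw [neg_sq, hq]) (by linear_combination -h)⟩

lemma nullVector_dotProduct_star (p q p' q' : ℂ) :
    nullVector p q ⬝ᵥ star (nullVector p' q') = 2 * (p * conj p' + q * conj q') ^ 2 := by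
  simp only [nullVector, dotProduct, Fin.sum_univ_three, cons_val, Pi.star_apply,
    Complex.star_def, map_sub, map_mul, map_add, map_pow, map_neg, Complex.conj_I, map_ofNat]
  linear_combination -((p ^ 2 + q ^ 2) * (conj p' ^ 2 + conj q' ^ 2)) * Complex.I_sq

/-- The coordinates of the harmonic polynomial `(a · x)^ℓ` in the basis of spherical harmonics,
where `a` is the null vector of the spinor `(p, q)`. -/
noncomputable def spinorCoeff (ℓ : ℕ) (p q : ℂ) (m : Order ℓ) : ℂ :=
  weight ℓ m * (p ^ (2 * ℓ - m.index) * q ^ m.index)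

lemma sphericalHarmonic_dotProduct_spinorCoeff (ℓ : ℕ) (x : S2) (p q : ℂ) :
    (fun m => sphericalHarmonic ℓ m x) ⬝ᵥ spinorCoeff ℓ p q =
      (nullVector p q ⬝ᵥ complexCoord x) ^ ℓ := by
  refine (sum_weight_mul_sphericalHarmonic ℓ x p q).trans ?_
  congr 1
  simp only [nullVector, dotProduct, Fin.sum_univ_three, cons_val, complexCoord]
  ring

/-- The hermitian product of two powers `(a · x)^ℓ`, `(a' · x)^ℓ`, computed in coordinates, depends
only on the hermitian product of `a` and `a'`. This makes the rotations act unitarily. -/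
lemma spinorCoeff_dotProduct_star (ℓ : ℕ) (p q p' q' : ℂ) :
    spinorCoeff ℓ p q ⬝ᵥ star (spinorCoeff ℓ p' q') =
      ((2 ^ ℓ * ℓ !) ^ 2 * (4 * Real.pi) / ((2 * ℓ + 1) * (2 * ℓ)!)) *
        (nullVector p q ⬝ᵥ star (nullVector p' q') / 2) ^ ℓ := by
  rw [nullVector_dotProduct_star, mul_div_cancel_left₀ _ two_ne_zero, ← pow_mul, add_comm (p * _),
    add_pow, ← sum_order_index ℓ fun k =>
      (q * conj q') ^ k * (p * conj p') ^ (2 * ℓ - k) * ((2 * ℓ).choose k : ℂ), Finset.mul_sum]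
  refine Finset.sum_congr rfl fun m _ => ?_
  have h := congrArg Complex.ofReal (weight_sq ℓ m)
  push_cast at h
  simp only [Pi.star_apply, spinorCoeff, star_mul', star_pow, Complex.star_def,
    Complex.conj_ofReal]
  rw [mul_pow, mul_pow]
  linear_combination (p ^ (2 * ℓ - m.index) * q ^ m.index) *
    (conj p' ^ (2 * ℓ - m.index) * conj q' ^ m.index) * h

/-- The columns are the coordinates of the powers `(a · x)^ℓ` for the `2ℓ + 1` null vectors `a`
with spinors `(1, 0), …, (1, 2ℓ)`. -/
noncomputable def spinorMatrix (ℓ : ℕ) : Matrix (Order ℓ) (Order ℓ) ℂ :=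
  of fun m j => spinorCoeff ℓ 1 j.index m

lemma isUnit_det_spinorMatrix (ℓ : ℕ) : IsUnit (spinorMatrix ℓ).det := by
  have h : spinorMatrix ℓ = diagonal (fun m => (weight ℓ m : ℂ)) *
      ((vandermonde fun j : Fin (2 * ℓ + 1) => (j : ℂ)).submatrix
        (orderEquiv ℓ) (orderEquiv ℓ))ᵀ := by
    ext m j
    simp [spinorMatrix, spinorCoeff, vandermonde_apply, orderEquiv]
  rw [h, det_mul, det_transpose, det_submatrix_equiv_self, det_diagonal, isUnit_iff_ne_zero]
  refine mul_ne_zero (Finset.prod_ne_zero_iff.2 fun m _ => ?_) (det_vandermonde_ne_zero_iff.2 ?_)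
  · exact_mod_cast (weight_pos ℓ m).ne'
  · intro i j hij
    exact Fin.ext (Nat.cast_injective (R := ℂ) hij)

lemma vecMul_spinorMatrix (ℓ : ℕ) (x : S2) :
    (fun m => sphericalHarmonic ℓ m x) ᵥ* spinorMatrix ℓ =
      fun j => (nullVector 1 j.index ⬝ᵥ complexCoord x) ^ ℓ := by
  ext j
  exact sphericalHarmonic_dotProduct_spinorCoeff ℓ x 1 j.index

lemma eq_vecMul_inv_spinorMatrix {ℓ : ℕ} {u w : Order ℓ → ℂ} (h : u ᵥ* spinorMatrix ℓ = w) :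
    u = w ᵥ* (spinorMatrix ℓ)⁻¹ := by
  rw [← h, vecMul_vecMul, mul_nonsing_inv _ (isUnit_det_spinorMatrix ℓ), vecMul_one]

/-- Two vectors with the same generating function agree. -/
lemma ext_spinorCoeff {ℓ : ℕ} {u w : Order ℓ → ℂ}
    (h : ∀ p q, u ⬝ᵥ spinorCoeff ℓ p q = w ⬝ᵥ spinorCoeff ℓ p q) : u = w := by
  rw [eq_vecMul_inv_spinorMatrix (ℓ := ℓ) (u := w) rfl]
  exact eq_vecMul_inv_spinorMatrix (funext fun j => h 1 j.index)

lemma continuous_complexCoord : Continuous complexCoord := by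
  unfold complexCoord
  fun_prop

/-- The azimuth in the definition of `Y_m^ℓ` jumps across a meridian, but by the generating function
`Y_m^ℓ` is a linear combination of the polynomials `(a · x)^ℓ`. -/
@[fun_prop]
lemma continuous_sphericalHarmonic (ℓ : ℕ) (m : Order ℓ) : Continuous (sphericalHarmonic ℓ m) := by
  have h : sphericalHarmonic ℓ m = fun x =>
      ((fun j : Order ℓ => (nullVector 1 j.index ⬝ᵥ complexCoord x) ^ ℓ) ᵥ*
        (spinorMatrix ℓ)⁻¹) m := by
    ext x
    rw [← eq_vecMul_inv_spinorMatrix (vecMul_spinorMatrix ℓ x)]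
  rw [h]
  simp only [vecMul, dotProduct]
  have := continuous_complexCoord
  fun_prop

/-- The spherical harmonics of degree `ℓ` transform under a rotation by a unitary matrix. -/
lemma exists_unitary_sphericalHarmonic (ℓ : ℕ) (g : SO3) :
    ∃ U : Matrix (Order ℓ) (Order ℓ) ℂ, Uᴴ * U = 1 ∧
      ∀ x, (fun m => sphericalHarmonic ℓ m (rotate g⁻¹ x)) =
        (fun m => sphericalHarmonic ℓ m x) ᵥ* U := by
  have hex (j : Order ℓ) : ∃ p q, nullVector p q = complexMatrix g *ᵥ nullVector 1 j.index :=
    exists_nullVector_eq (by rw [complexMatrix_mulVec_dotProduct, nullVector_dotProduct_self])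
  choose p q hpq using hex
  set W := spinorMatrix ℓ with hW
  set W' : Matrix (Order ℓ) (Order ℓ) ℂ := of fun m j => spinorCoeff ℓ (p j) (q j) m with hW'
  have hunit : IsUnit W.det := isUnit_det_spinorMatrix ℓ
  -- rotating the null vectors preserves their hermitian products
  have hgram : W'ᵀ * W'.map star = Wᵀ * W.map star := by
    ext i j
    change spinorCoeff ℓ (p i) (q i) ⬝ᵥ star (spinorCoeff ℓ (p j) (q j)) =
      spinorCoeff ℓ 1 i.index ⬝ᵥ star (spinorCoeff ℓ 1 j.index)
    rw [spinorCoeff_dotProduct_star, spinorCoeff_dotProduct_star, hpq, hpq,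
      star_complexMatrix_mulVec, complexMatrix_mulVec_dotProduct]
  have hgram' : W'ᴴ * W' = Wᴴ * W := by
    have := congrArg Matrix.transpose hgram
    rw [transpose_mul, transpose_mul, transpose_transpose, transpose_transpose] at this
    exact this
  refine ⟨W' * W⁻¹, ?_, fun x => ?_⟩
  · have hunit' : IsUnit Wᴴ.det := by rw [det_conjTranspose]; exact hunit.star
    calc (W' * W⁻¹)ᴴ * (W' * W⁻¹) = (W⁻¹)ᴴ * (W'ᴴ * W') * W⁻¹ := by
          rw [conjTranspose_mul]; simp only [Matrix.mul_assoc]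
      _ = 1 := by
          rw [hgram', conjTranspose_nonsing_inv, ← Matrix.mul_assoc, nonsing_inv_mul _ hunit',
            Matrix.one_mul, mul_nonsing_inv _ hunit]
  · have h1 : (fun m => sphericalHarmonic ℓ m x) ᵥ* W' =
        fun j => (nullVector 1 j.index ⬝ᵥ complexCoord (rotate g⁻¹ x)) ^ ℓ := by
      ext j
      rw [dotProduct_complexCoord_rotate_inv, ← hpq]
      exact sphericalHarmonic_dotProduct_spinorCoeff ℓ x (p j) (q j)
    rw [← vecMul_vecMul, h1]
    exact eq_vecMul_inv_spinorMatrix (vecMul_spinorMatrix ℓ _)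

/-- On the polar axis the generating function is `(2pq)^ℓ` and only the order `0` survives. -/
lemma sphericalHarmonic_northPole (ℓ : ℕ) (m : Order ℓ) :
    sphericalHarmonic ℓ m northPole =
      if m = Order.zero ℓ then (2 ^ ℓ / weight ℓ (Order.zero ℓ) : ℂ) else 0 := by
  have hw : (weight ℓ (Order.zero ℓ) : ℂ) ≠ 0 := by exact_mod_cast (weight_pos ℓ _).ne'
  refine congrFun (a := m) (ext_spinorCoeff
    (u := fun m => sphericalHarmonic ℓ m northPole) (w := fun m => if m = Order.zero ℓ then
    (2 ^ ℓ / weight ℓ (Order.zero ℓ) : ℂ) else 0) fun p q => ?_)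
  have h : nullVector p q ⬝ᵥ complexCoord northPole = 2 * p * q := by
    simp [nullVector, complexCoord, northPole, dotProduct, Fin.sum_univ_three]
  rw [sphericalHarmonic_dotProduct_spinorCoeff, h]
  simp only [dotProduct, ite_mul, zero_mul, Finset.sum_ite_eq', Finset.mem_univ, if_true,
    spinorCoeff, Order.index_zero, show 2 * ℓ - ℓ = ℓ by omega, mul_pow]
  field_simp

lemma sq_two_pow_div_weight_zero (ℓ : ℕ) :
    (2 ^ ℓ / weight ℓ (Order.zero ℓ) : ℝ) ^ 2 = (2 * ℓ + 1) / (4 * Real.pi) := by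
  have h := (Nat.add_choose_mul_factorial_mul_factorial ℓ ℓ)
  rw [← two_mul] at h
  have h' : ((2 * ℓ).choose ℓ : ℝ) * ℓ ! * ℓ ! = (2 * ℓ)! := by exact_mod_cast h
  have h0 : ((2 * ℓ)! : ℝ) ≠ 0 := by positivity
  have h1 : ((2 * ℓ).choose ℓ : ℝ) ≠ 0 := fun h => h0 (by rw [← h', h]; ring)
  rw [div_pow, weight_sq, Order.index_zero, ← h']
  field_simp

lemma sphericalHarmonic_polarRotation (ℓ : ℕ) (m : Order ℓ) (α : ℝ) (x : S2) :
    sphericalHarmonic ℓ m (rotate (polarRotation α)⁻¹ x) =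
      Complex.exp (-(m.1 * α * Complex.I)) * sphericalHarmonic ℓ m x := by
  refine congrFun (a := m) (ext_spinorCoeff
    (u := fun m => sphericalHarmonic ℓ m (rotate (polarRotation α)⁻¹ x))
    (w := fun m => Complex.exp (-(m.1 * α * Complex.I)) * sphericalHarmonic ℓ m x) fun p q => ?_)
  -- the polar rotation acts on spinors by opposite half-angle phases
  set c := Complex.exp (α / 2 * Complex.I) with hc
  set c' := Complex.exp (-(α / 2 * Complex.I)) with hc'
  have hcc : c * c' = 1 := by rw [hc, hc', ← Complex.exp_add, add_neg_cancel, Complex.exp_zero]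
  have hc2 : c ^ 2 = Complex.cos α + Complex.sin α * Complex.I := by
    rw [hc, ← Complex.exp_nat_mul, ← Complex.exp_mul_I]
    congr 1; push_cast; ring
  have hc2' : c' ^ 2 = Complex.cos α - Complex.sin α * Complex.I := by
    rw [hc', ← Complex.exp_nat_mul]
    have : ((2 : ℕ) : ℂ) * -(α / 2 * Complex.I) = (-α : ℂ) * Complex.I := by push_cast; ring
    rw [this, Complex.exp_mul_I, Complex.cos_neg, Complex.sin_neg]
    ring
  have hv : complexMatrix (polarRotation α) *ᵥ nullVector p q = nullVector (c * p) (c' * q) := by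
    ext i
    fin_cases i
    · simp [complexMatrix, polarRotation, nullVector, mulVec, dotProduct, Fin.sum_univ_three,
        mul_pow, hc2, hc2']
      ring
    · simp [complexMatrix, polarRotation, nullVector, mulVec, dotProduct, Fin.sum_univ_three,
        mul_pow, hc2, hc2']
      linear_combination Complex.sin α * (p ^ 2 - q ^ 2) * Complex.I_sq
    · simp [complexMatrix, polarRotation, nullVector, mulVec, dotProduct, Fin.sum_univ_three]
      linear_combination -(2 * p * q) * hcc
  rw [sphericalHarmonic_dotProduct_spinorCoeff, dotProduct_complexCoord_rotate_inv, hv,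
    ← sphericalHarmonic_dotProduct_spinorCoeff]
  refine Finset.sum_congr rfl fun m _ => ?_
  have he : c ^ (2 * ℓ - m.index) * c' ^ m.index = Complex.exp (-(m.1 * α * Complex.I)) := by
    rw [hc, hc', ← Complex.exp_nat_mul, ← Complex.exp_nat_mul, ← Complex.exp_add]
    congr 1
    have h1 : (m.index : ℂ) = ℓ + m.1 := by exact_mod_cast m.coe_index
    rw [Nat.cast_sub m.index_le, h1]
    push_cast
    ring
  simp only [← he, spinorCoeff, mul_pow]
  ring

/-! ### Orthonormality and the representation property -/

lemma integrable_of_continuous {h : S2 → ℂ} (hh : Continuous h) : Integrable h surfaceMeasure :=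
  hh.integrable_of_hasCompactSupport (HasCompactSupport.of_compactSpace h)

/-- The Gram matrix of the spherical harmonics of degree `ℓ` in `L²(S²)`. -/
noncomputable def gram (ℓ : ℕ) : Matrix (Order ℓ) (Order ℓ) ℂ :=
  of fun m n => ∫ x, sphericalHarmonic ℓ m x * conj (sphericalHarmonic ℓ n x) ∂surfaceMeasure

lemma integral_dotProduct_mul_conj (ℓ : ℕ) (u w : Order ℓ → ℂ) :
    ∫ x, ((fun m => sphericalHarmonic ℓ m x) ⬝ᵥ u) *
      conj ((fun m => sphericalHarmonic ℓ m x) ⬝ᵥ w) ∂surfaceMeasure =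
      u ⬝ᵥ gram ℓ *ᵥ star w := by
  have h (x : S2) : ((fun m => sphericalHarmonic ℓ m x) ⬝ᵥ u) *
      conj ((fun m => sphericalHarmonic ℓ m x) ⬝ᵥ w) =
      ∑ m, ∑ n, (u m * conj (w n)) *
        (sphericalHarmonic ℓ m x * conj (sphericalHarmonic ℓ n x)) := by
    simp only [dotProduct, map_sum, map_mul, Finset.sum_mul_sum]
    refine Finset.sum_congr rfl fun m _ => Finset.sum_congr rfl fun n _ => ?_
    ring
  have hint (m n : Order ℓ) : Integrable (fun x => (u m * conj (w n)) *
        (sphericalHarmonic ℓ m x * conj (sphericalHarmonic ℓ n x))) surfaceMeasure :=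
    integrable_of_continuous (by fun_prop)
  simp_rw [h]
  rw [integral_finsetSum _ fun m _ => integrable_finsetSum _ fun n _ => hint m n]
  simp_rw [dotProduct, mulVec, dotProduct, Finset.mul_sum]
  refine Finset.sum_congr rfl fun m _ => ?_
  rw [integral_finsetSum _ fun n _ => hint m n]
  refine Finset.sum_congr rfl fun n _ => ?_
  rw [integral_const_mul, gram, of_apply, Pi.star_apply, Complex.star_def]
  ring

lemma gram_of_ne {ℓ : ℕ} {m n : Order ℓ} (h : m ≠ n) : gram ℓ m n = 0 := by
  have hd : (m.1 - n.1 : ℝ) ≠ 0 := by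
    rw [sub_ne_zero]
    exact fun h' => h (Subtype.ext (Int.cast_injective h'))
  -- rotate about the polar axis by the angle for which the integrand changes sign
  set α : ℝ := Real.pi / (m.1 - n.1 : ℝ) with hα
  have hexp : Complex.exp (-(m.1 * α * Complex.I)) *
      conj (Complex.exp (-(n.1 * α * Complex.I))) = -1 := by
    have hd' : (m.1 - n.1 : ℂ) ≠ 0 := by exact_mod_cast hd
    rw [← Complex.exp_conj, ← Complex.exp_add]
    simp only [map_neg, map_mul, Complex.conj_I, Complex.conj_ofReal, map_intCast]
    have : (-(m.1 * α * Complex.I) + -(n.1 * α * -Complex.I) : ℂ) = -(Real.pi * Complex.I) := by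
      rw [hα]
      push_cast
      field_simp
      ring
    rw [this, Complex.exp_neg, Complex.exp_pi_mul_I]
    norm_num
  have key := integral_rotate (polarRotation α)⁻¹ fun x =>
    sphericalHarmonic ℓ m x * conj (sphericalHarmonic ℓ n x)
  have h2 (x : S2) : sphericalHarmonic ℓ m (rotate (polarRotation α)⁻¹ x) *
      conj (sphericalHarmonic ℓ n (rotate (polarRotation α)⁻¹ x)) =
      -1 * (sphericalHarmonic ℓ m x * conj (sphericalHarmonic ℓ n x)) := by
    rw [sphericalHarmonic_polarRotation, sphericalHarmonic_polarRotation, map_mul, ← hexp]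
    ring
  simp_rw [h2] at key
  rw [integral_const_mul] at key
  rw [gram, of_apply]
  linear_combination (-1 / 2 : ℂ) * key

lemma sphericalHarmonic_rotate_inv_northPole {ℓ : ℕ} {g : SO3} {U : Matrix (Order ℓ) (Order ℓ) ℂ}
    (hU : ∀ x, (fun m => sphericalHarmonic ℓ m (rotate g⁻¹ x)) =
        (fun m => sphericalHarmonic ℓ m x) ᵥ* U) (n : Order ℓ) :
    sphericalHarmonic ℓ n (rotate g⁻¹ northPole) =
      sphericalHarmonic ℓ (Order.zero ℓ) northPole * U (Order.zero ℓ) n := by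
  refine (congrFun (hU northPole) n).trans ?_
  rw [vecMul, dotProduct, Finset.sum_eq_single (Order.zero ℓ)]
  · intro m _ hm
    rw [sphericalHarmonic_northPole, if_neg hm, zero_mul]
  · simp

lemma sphericalHarmonic_zero_northPole_mul_self (ℓ : ℕ) :
    sphericalHarmonic ℓ (Order.zero ℓ) northPole * sphericalHarmonic ℓ (Order.zero ℓ) northPole =
      (2 * ℓ + 1) / (4 * Real.pi) := by
  rw [sphericalHarmonic_northPole, if_pos rfl, ← pow_two]
  have := congrArg Complex.ofReal (sq_two_pow_div_weight_zero ℓ)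
  push_cast at this
  exact this

lemma conj_sphericalHarmonic_zero_northPole (ℓ : ℕ) :
    conj (sphericalHarmonic ℓ (Order.zero ℓ) northPole) =
      sphericalHarmonic ℓ (Order.zero ℓ) northPole := by
  rw [sphericalHarmonic_northPole, if_pos rfl, map_div₀, map_pow, Complex.conj_ofReal, map_ofNat]

lemma two_mul_add_one_ne_zero (ℓ : ℕ) : (2 * ℓ + 1 : ℂ) ≠ 0 := by
  exact_mod_cast (2 * ℓ).succ_ne_zero

lemma complex_pi_ne_zero : (Real.pi : ℂ) ≠ 0 := by exact_mod_cast Real.pi_ne_zero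

lemma sphericalHarmonic_zero_northPole_ne_zero (ℓ : ℕ) :
    sphericalHarmonic ℓ (Order.zero ℓ) northPole ≠ 0 := by
  intro h
  have := sphericalHarmonic_zero_northPole_mul_self ℓ
  rw [h, zero_mul, eq_comm] at this
  exact div_ne_zero (two_mul_add_one_ne_zero ℓ) (mul_ne_zero (by norm_num) complex_pi_ne_zero) this

/-- Unsöld's theorem: the sum of `|Y_m|²` over all orders is constant on the sphere. -/
lemma sum_sphericalHarmonic_mul_conj (ℓ : ℕ) (x : S2) :
    ∑ m, sphericalHarmonic ℓ m x * conj (sphericalHarmonic ℓ m x) =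
      (2 * ℓ + 1) / (4 * Real.pi) := by
  obtain ⟨g, hg⟩ := exists_rotate_northPole_eq x
  obtain ⟨U, hU, hY⟩ := exists_unitary_sphericalHarmonic ℓ g⁻¹
  rw [inv_inv] at hY
  have hUU : U * Uᴴ = 1 := mul_eq_one_comm.1 hU
  have h0 : ∑ n, U (Order.zero ℓ) n * conj (U (Order.zero ℓ) n) = 1 := by
    have := congrFun (congrFun hUU (Order.zero ℓ)) (Order.zero ℓ)
    rw [mul_apply, one_apply_eq] at this
    exact this
  have hn (n : Order ℓ) : sphericalHarmonic ℓ n x =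
      sphericalHarmonic ℓ (Order.zero ℓ) northPole * U (Order.zero ℓ) n := by
    have := sphericalHarmonic_rotate_inv_northPole (g := g⁻¹) (by rwa [inv_inv]) n
    rwa [inv_inv, hg] at this
  calc _ = ∑ n, (2 * ℓ + 1) / (4 * Real.pi : ℂ) *
        (U (Order.zero ℓ) n * conj (U (Order.zero ℓ) n)) := by
        refine Finset.sum_congr rfl fun n _ => ?_
        rw [hn, map_mul, conj_sphericalHarmonic_zero_northPole,
          ← sphericalHarmonic_zero_northPole_mul_self]
        ring
    _ = _ := by rw [← Finset.mul_sum, h0, mul_one]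

open Polynomial in
/-- The derivative of order `ℓ + m` of `(1 - s²)^ℓ`, a nonzero polynomial, has only finitely many
zeros. -/
lemma exists_sphericalHarmonic_ne_zero (ℓ : ℕ) (m : Order ℓ) :
    ∃ x, sphericalHarmonic ℓ m x ≠ 0 := by
  have hpoly : hasseDeriv m.index ((1 - X ^ 2) ^ ℓ : ℝ[X]) ≠ 0 := by
    intro h
    have hc := congrArg (fun P => P.coeff (2 * ℓ - m.index)) h
    have hdeg : ((1 - X ^ 2 : ℝ[X])).natDegree ≤ 2 := by compute_degree
    have hlead : ((1 - X ^ 2 : ℝ[X])).coeff 2 = -1 := by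
      simp [coeff_one]
    have hcoeff : ((1 - X ^ 2) ^ ℓ : ℝ[X]).coeff (2 * ℓ) = (-1) ^ ℓ := by
      rw [mul_comm 2 ℓ, coeff_pow_of_natDegree_le hdeg, hlead]
    simp only [hasseDeriv_coeff, Nat.sub_add_cancel m.index_le, hcoeff, coeff_zero] at hc
    rcases mul_eq_zero.1 hc with h | h
    · exact (Nat.choose_pos m.index_le).ne' (by exact_mod_cast h)
    · exact pow_ne_zero ℓ (by norm_num : (-1 : ℝ) ≠ 0) h
  obtain ⟨t, ht, hQ⟩ : ∃ t ∈ Set.Ioo (-1 : ℝ) 1, rodriguesCoeff ℓ t m.index ≠ 0 := by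
    by_contra! hcon
    refine hpoly (eq_zero_of_infinite_isRoot _ ((Set.Ioo_infinite (by norm_num)).mono
      (s := Set.Ioo (-1 : ℝ) 1) fun t ht => ?_))
    have := hcon t ht
    rwa [rodriguesCoeff, taylor_coeff] at this
  have hpos : 0 < 1 - t ^ 2 := by nlinarith [ht.1, ht.2]
  let x : S2 := ⟨!₂[√(1 - t ^ 2), 0, t], by
    simp [EuclideanSpace.norm_eq, Fin.sum_univ_three, Real.sq_sqrt hpos.le]⟩
  have hx : x.1 2 = t := rfl
  refine ⟨x, fun h => ?_⟩
  have key := weight_mul_sphericalHarmonic ℓ m x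
  rw [h, mul_zero, hx, eq_comm] at key
  refine mul_ne_zero (mul_ne_zero (pow_ne_zero _ (by norm_num)) ?_)
    (mul_ne_zero ?_ (Complex.exp_ne_zero _)) key
  · exact_mod_cast hQ
  · exact_mod_cast (Real.rpow_pos_of_pos hpos _).ne'

/-- The spherical harmonics of degree `ℓ` are orthonormal. The Gram matrix commutes with the
conjugates of the rotation matrices, which forces its diagonal to be constant, and Unsöld's theorem fixes its
trace. -/
theorem gram_eq_one (ℓ : ℕ) : gram ℓ = 1 := by
  have hdiag : gram ℓ = diagonal fun m => gram ℓ m m := by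
    ext m n
    by_cases h : m = n
    · rw [h, diagonal_apply_eq]
    · rw [gram_of_ne h, diagonal_apply_ne _ h]
  have hconst (n : Order ℓ) : gram ℓ n n = gram ℓ (Order.zero ℓ) (Order.zero ℓ) := by
    obtain ⟨x, hx⟩ := exists_sphericalHarmonic_ne_zero ℓ n
    obtain ⟨g, hg⟩ := exists_rotate_northPole_eq x
    obtain ⟨U, hU, hY⟩ := exists_unitary_sphericalHarmonic ℓ g⁻¹
    -- `U 0 n` is a nonzero multiple of `Y_n(x)` and links the order `n` to the order `0`
    have hn := sphericalHarmonic_rotate_inv_northPole hY n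
    rw [inv_inv, hg] at hn
    have hU0 : U (Order.zero ℓ) n ≠ 0 := fun h => hx (by rw [hn, h, mul_zero])
    have hinv : Uᵀ * gram ℓ * U.map star = gram ℓ := by
      ext i j
      have h1 := integral_rotate (g⁻¹)⁻¹ fun x =>
        sphericalHarmonic ℓ i x * conj (sphericalHarmonic ℓ j x)
      have h2 (x : S2) (i : Order ℓ) : sphericalHarmonic ℓ i (rotate (g⁻¹)⁻¹ x) =
          (fun m => sphericalHarmonic ℓ m x) ⬝ᵥ fun m => U m i := congrFun (hY x) i
      simp_rw [h2] at h1
      rw [integral_dotProduct_mul_conj, dotProduct_mulVec] at h1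
      exact h1
    have hUT : U.map star * Uᵀ = 1 := by
      have := congrArg Matrix.transpose (mul_eq_one_comm.1 hU)
      rw [transpose_mul, transpose_one] at this
      exact this
    have hcomm : U.map star * gram ℓ = gram ℓ * U.map star := by
      conv_lhs => rw [← hinv]
      rw [← Matrix.mul_assoc, ← Matrix.mul_assoc, hUT, Matrix.one_mul]
    have := congrFun (congrFun hcomm (Order.zero ℓ)) n
    rw [hdiag, mul_diagonal, diagonal_mul, map_apply, mul_comm] at this
    exact mul_right_cancel₀ (star_ne_zero.2 hU0) this
  have htrace : ∑ m, gram ℓ m m = 2 * ℓ + 1 := by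
    simp only [gram, of_apply]
    rw [← integral_finsetSum _ fun m _ => integrable_of_continuous (by fun_prop)]
    simp_rw [sum_sphericalHarmonic_mul_conj]
    rw [integral_const, measureReal_def, surfaceMeasure_univ, ENNReal.toReal_ofReal (by positivity),
      Complex.real_smul]
    push_cast
    have := complex_pi_ne_zero
    field_simp
  have hcard : Fintype.card (Order ℓ) = 2 * ℓ + 1 := by
    rw [Fintype.card_congr (orderEquiv ℓ), Fintype.card_fin]
  simp_rw [hconst] at htrace
  rw [Finset.sum_const, Finset.card_univ, hcard, nsmul_eq_mul] at htrace
  push_cast at htrace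
  have hone := mul_left_cancel₀ (two_mul_add_one_ne_zero ℓ) (htrace.trans (mul_one _).symm)
  rw [hdiag]
  simp_rw [hconst, hone]
  exact diagonal_one

lemma eq_wignerD {ℓ : ℕ} {g : SO3} {U : Matrix (Order ℓ) (Order ℓ) ℂ}
    (hY : ∀ x, (fun m => sphericalHarmonic ℓ m (rotate g⁻¹ x)) =
      (fun m => sphericalHarmonic ℓ m x) ᵥ* U) : U = wignerD ℓ g := by
  ext m n
  have h1 (x : S2) : sphericalHarmonic ℓ n (rotate g⁻¹ x) * conj (sphericalHarmonic ℓ m x) =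
      ((fun m => sphericalHarmonic ℓ m x) ⬝ᵥ fun i => U i n) *
        conj ((fun m => sphericalHarmonic ℓ m x) ⬝ᵥ Pi.single m 1) := by
    rw [dotProduct_single_one]
    exact congrArg (· * _) (congrFun (hY x) n)
  simp_rw [wignerD, of_apply, h1]
  rw [integral_dotProduct_mul_conj, gram_eq_one, one_mulVec]
  simp [dotProduct, Pi.single_apply, apply_ite]

lemma wignerD_unitary (ℓ : ℕ) (g : SO3) : (wignerD ℓ g)ᴴ * wignerD ℓ g = 1 := by
  obtain ⟨U, hU, hY⟩ := exists_unitary_sphericalHarmonic ℓ g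
  rwa [← eq_wignerD hY]

lemma sphericalHarmonic_rotate_inv (ℓ : ℕ) (g : SO3) (x : S2) :
    (fun m => sphericalHarmonic ℓ m (rotate g⁻¹ x)) =
      (fun m => sphericalHarmonic ℓ m x) ᵥ* wignerD ℓ g := by
  obtain ⟨U, hU, hY⟩ := exists_unitary_sphericalHarmonic ℓ g
  rw [hY, ← eq_wignerD hY]

lemma wignerD_mul (ℓ : ℕ) (g h : SO3) : wignerD ℓ (g * h) = wignerD ℓ g * wignerD ℓ h := by
  refine (eq_wignerD fun x => ?_).symm
  simp_rw [_root_.mul_inv_rev, rotate_mul]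
  rw [sphericalHarmonic_rotate_inv ℓ h, sphericalHarmonic_rotate_inv ℓ g, vecMul_vecMul]

lemma sphericalHarmonic_rotate (ℓ : ℕ) (g : SO3) (x : S2) :
    (fun m => sphericalHarmonic ℓ m (rotate g x)) =
      (wignerD ℓ g).map conj *ᵥ fun m => sphericalHarmonic ℓ m x := by
  have h := sphericalHarmonic_rotate_inv ℓ g (rotate g x)
  rw [rotate_inv_rotate] at h
  rw [h, mulVec_vecMul]
  have : (wignerD ℓ g).map conj * (wignerD ℓ g)ᵀ = 1 := by
    have := congrArg Matrix.transpose (mul_eq_one_comm.1 (wignerD_unitary ℓ g))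
    rw [transpose_mul, transpose_one] at this
    exact this
  rw [this, one_mulVec]

lemma wignerD_polarRotation (ℓ : ℕ) (α : ℝ) :
    wignerD ℓ (polarRotation α) = diagonal fun m => Complex.exp (-(m.1 * α * Complex.I)) := by
  refine (eq_wignerD fun x => ?_).symm
  ext m
  rw [vecMul_diagonal, sphericalHarmonic_polarRotation, mul_comm]

lemma continuous_wignerD (ℓ : ℕ) (m n : Order ℓ) : Continuous fun g => wignerD ℓ g m n := by
  have := continuous_parametric_integral_of_continuous (μ := surfaceMeasure)
    (f := fun (g : SO3) x => sphericalHarmonic ℓ n (rotate g⁻¹ x) *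
      conj (sphericalHarmonic ℓ m x)) (by
        simp only [Function.uncurry_def]
        have := continuous_sphericalHarmonic ℓ n
        have := continuous_sphericalHarmonic ℓ m
        fun_prop) isCompact_univ
  simp only [Measure.restrict_univ] at this
  exact this

/-! ### Averages over the group and the Fourier coefficients of the correlation -/

lemma integrable_mul_of_continuous {X : Type*} [TopologicalSpace X] [CompactSpace X]
    [SecondCountableTopology X] [MeasurableSpace X] [BorelSpace X] {μ : Measure X} {F c : X → ℂ}
    (hF : Integrable F μ) (hc : Continuous c) : Integrable (fun x => F x * c x) μ := by
  obtain ⟨C, hC⟩ := (isCompact_range hc).isBounded.exists_norm_le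
  exact hF.mul_bdd hc.aestronglyMeasurable (ae_of_all _ fun x => hC _ ⟨x, rfl⟩)

lemma integrable_mul_conj_wignerD {F : SO3 → ℂ} (hF : Integrable F haarSO3) (ℓ : ℕ)
    (m n : Order ℓ) : Integrable (fun g => F g * conj (wignerD ℓ g m n)) haarSO3 :=
  integrable_mul_of_continuous hF (Complex.continuous_conj.comp (continuous_wignerD ℓ m n))

/-- The vector, indexed by `m`, of the averages over `g` of `k (g⁻¹ x)` against the conjugates of
the entries `ρ_ℓ^{mn}(g)` in the column `n`. -/
noncomputable def columnAverage (k : S2 → ℂ) (ℓ : ℕ) (n : Order ℓ) (x : S2) : Order ℓ → ℂ :=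
  fun m => ∫ g, k (rotate g⁻¹ x) * conj (wignerD ℓ g m n) ∂haarSO3

lemma columnAverage_rotate {k : S2 → ℂ} (hk : Integrable k surfaceMeasure) (ℓ : ℕ) (n : Order ℓ)
    (h : SO3) (x : S2) :
    columnAverage k ℓ n (rotate h x) = (wignerD ℓ h).map conj *ᵥ columnAverage k ℓ n x := by
  ext m
  rw [columnAverage, ← integral_mul_left_eq_self _ h]
  have (g : SO3) : k (rotate (h * g)⁻¹ (rotate h x)) * conj (wignerD ℓ (h * g) m n) =
      ∑ i, conj (wignerD ℓ h m i) * (k (rotate g⁻¹ x) * conj (wignerD ℓ g i n)) := by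
    rw [_root_.mul_inv_rev, rotate_mul, rotate_inv_rotate, wignerD_mul, mul_apply, map_sum,
      Finset.mul_sum]
    refine Finset.sum_congr rfl fun i _ => ?_
    rw [map_mul]
    ring
  simp_rw [this]
  rw [integral_finsetSum _ fun i _ =>
    (integrable_mul_conj_wignerD (integrable_orbit hk x) ℓ i n).const_mul _]
  simp_rw [integral_const_mul]
  rfl

/-- At the pole, invariance under the polar rotations leaves only the component of order `0`. -/
lemma columnAverage_northPole {k : S2 → ℂ} (hk : Integrable k surfaceMeasure) (ℓ : ℕ)
    (n : Order ℓ) :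
    columnAverage k ℓ n northPole = ((2 * ℓ + 1 : ℂ)⁻¹ * sphCoeff k ℓ n) •
      fun m => sphericalHarmonic ℓ m northPole := by
  ext m
  rw [Pi.smul_apply, smul_eq_mul]
  by_cases hm : m = Order.zero ℓ
  · subst hm
    set y := sphericalHarmonic ℓ (Order.zero ℓ) northPole with hy
    have hy0 : y ≠ 0 := sphericalHarmonic_zero_northPole_ne_zero ℓ
    have h1 (g : SO3) : k (rotate g⁻¹ northPole) * conj (wignerD ℓ g (Order.zero ℓ) n) =
        y⁻¹ * (k (rotate g⁻¹ northPole) *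
          conj (sphericalHarmonic ℓ n (rotate g⁻¹ northPole))) := by
      rw [sphericalHarmonic_rotate_inv_northPole (sphericalHarmonic_rotate_inv ℓ g) n, map_mul,
        conj_sphericalHarmonic_zero_northPole, ← hy]
      field_simp
    have hint : Integrable (fun x => k x * conj (sphericalHarmonic ℓ n x)) surfaceMeasure :=
      integrable_mul_of_continuous hk (by fun_prop)
    rw [columnAverage]
    simp_rw [h1]
    rw [integral_const_mul, integral_orbit hint northPole]
    change y⁻¹ * ((4 * Real.pi : ℂ)⁻¹ * sphCoeff k ℓ n) = _
    have h2 : y * y = (2 * ℓ + 1) / (4 * Real.pi) := sphericalHarmonic_zero_northPole_mul_self ℓ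
    have hl := two_mul_add_one_ne_zero ℓ
    have hpi := complex_pi_ne_zero
    field_simp at h2 ⊢
    linear_combination -sphCoeff k ℓ n * h2
  · have hm0 : (m.1 : ℂ) ≠ 0 := by
      rw [Int.cast_ne_zero]
      exact fun h => hm (Subtype.ext h)
    -- the rotation by `π / m` fixes the pole and changes the sign of the component of order `m`
    have h := congrFun (columnAverage_rotate hk ℓ n (polarRotation (Real.pi / m.1)) northPole) m
    have hexp : conj (Complex.exp (-(m.1 * ((Real.pi / m.1 : ℝ) : ℂ) * Complex.I))) = -1 := by
      have : (m.1 * ((Real.pi / m.1 : ℝ) : ℂ) * Complex.I : ℂ) = Real.pi * Complex.I := by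
        push_cast
        field_simp
      rw [this, Complex.exp_neg, Complex.exp_pi_mul_I]
      norm_num
    rw [rotate_polarRotation_northPole, wignerD_polarRotation, diagonal_map (map_zero _),
      mulVec_diagonal] at h
    simp only [hexp] at h
    rw [sphericalHarmonic_northPole, if_neg hm, mul_zero]
    linear_combination (1 / 2 : ℂ) * h

/-- As functions of `x` both sides transform in the same way under rotations, so they agree because
they agree at the pole. -/
lemma columnAverage_eq {k : S2 → ℂ} (hk : Integrable k surfaceMeasure) (ℓ : ℕ)
    (n : Order ℓ) (x : S2) :
    columnAverage k ℓ n x = ((2 * ℓ + 1 : ℂ)⁻¹ * sphCoeff k ℓ n) •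
      fun m => sphericalHarmonic ℓ m x := by
  obtain ⟨g, rfl⟩ := exists_rotate_northPole_eq x
  rw [columnAverage_rotate hk, columnAverage_northPole hk, mulVec_smul, sphericalHarmonic_rotate]

section Correlation

variable {f k : S2 → ℂ}

lemma memLp_rotate (hk : MemLp k 2 surfaceMeasure) (g : SO3) :
    MemLp (fun x => k (rotate g x)) 2 surfaceMeasure :=
  hk.comp_measurePreserving (measurePreserving_rotate g)

lemma integrable_correlation (hf : MemLp f 2 surfaceMeasure) (hk : MemLp k 2 surfaceMeasure)
    (g : SO3) : Integrable (fun x => k (rotate g⁻¹ x) * f x) surfaceMeasure :=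
  (memLp_rotate hk g⁻¹).integrable_mul hf

lemma integrable_prod_correlation (hf : MemLp f 2 surfaceMeasure)
    (hk : MemLp k 2 surfaceMeasure) :
    Integrable (fun p : SO3 × S2 => k (rotate p.1⁻¹ p.2) * f p.2)
      (haarSO3.prod surfaceMeasure) := by
  have hT : MeasurePreserving (fun p : SO3 × S2 => (p.1, rotate p.1⁻¹ p.2))
      (haarSO3.prod surfaceMeasure) (haarSO3.prod surfaceMeasure) :=
    (MeasurePreserving.id haarSO3).skew_product (g := fun g x => rotate g⁻¹ x)
      (show Continuous fun p : SO3 × S2 => rotate p.1⁻¹ p.2 by fun_prop).measurable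
      (ae_of_all _ fun g => (measurePreserving_rotate g⁻¹).map_eq)
  have h1 : MemLp (fun p : SO3 × S2 => k (rotate p.1⁻¹ p.2)) 2 (haarSO3.prod surfaceMeasure) :=
    (hk.comp_snd haarSO3).comp_measurePreserving hT
  exact h1.integrable_mul (hf.comp_snd haarSO3)

lemma norm_crossCorrelation_le (hf : MemLp f 2 surfaceMeasure) (hk : MemLp k 2 surfaceMeasure)
    (g : SO3) :
    ‖crossCorrelation f k g‖ ≤
      ∫ x, ‖k x‖ ^ 2 ∂surfaceMeasure + ∫ x, ‖f x‖ ^ 2 ∂surfaceMeasure := by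
  have hk' := (memLp_rotate hk g⁻¹).norm.integrable_sq
  have hf' := hf.norm.integrable_sq
  calc ‖crossCorrelation f k g‖ ≤
        ∫ x, (‖k (rotate g⁻¹ x)‖ ^ 2 + ‖f x‖ ^ 2) ∂surfaceMeasure := by
        refine norm_integral_le_of_norm_le (hk'.add hf') (ae_of_all _ fun x => ?_)
        rw [norm_mul]
        nlinarith [sq_nonneg (‖k (rotate g⁻¹ x)‖ - ‖f x‖), sq_nonneg ‖k (rotate g⁻¹ x)‖,
          sq_nonneg ‖f x‖]
    _ = _ := by
        rw [integral_add hk' hf']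
        congr 1
        exact integral_rotate g⁻¹ fun x => ‖k x‖ ^ 2

lemma memLp_crossCorrelation (hf : MemLp f 2 surfaceMeasure) (hk : MemLp k 2 surfaceMeasure) :
    MemLp (crossCorrelation f k) 2 haarSO3 :=
  MemLp.of_bound (integrable_prod_correlation hf hk).integral_prod_left.aestronglyMeasurable _
    (ae_of_all _ (norm_crossCorrelation_le hf hk))

/-- The formula for the Fourier coefficients, without any reality assumption. Both formulas for
real-valued functions are special cases. -/
lemma integral_crossCorrelation_mul_conj_wignerD (hf : MemLp f 2 surfaceMeasure)
    (hk : MemLp k 2 surfaceMeasure) (ℓ : ℕ) (m n : Order ℓ) :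
    (2 * ℓ + 1) * ∫ g, crossCorrelation f k g * conj (wignerD ℓ g m n) ∂haarSO3 =
      sphCoeff k ℓ n * ∫ x, f x * sphericalHarmonic ℓ m x ∂surfaceMeasure := by
  have hc : Continuous fun p : SO3 × S2 => conj (wignerD ℓ p.1 m n) :=
    Complex.continuous_conj.comp ((continuous_wignerD ℓ m n).comp continuous_fst)
  have hint := integrable_mul_of_continuous (integrable_prod_correlation hf hk) hc
  have h1 : ∫ g, crossCorrelation f k g * conj (wignerD ℓ g m n) ∂haarSO3 =
      ∫ x, f x * columnAverage k ℓ n x m ∂surfaceMeasure := by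
    simp_rw [crossCorrelation, ← integral_mul_const]
    rw [integral_integral_swap hint]
    refine integral_congr_ae (ae_of_all _ fun x => ?_)
    simp only [columnAverage]
    rw [← integral_const_mul]
    refine integral_congr_ae (ae_of_all _ fun g => ?_)
    ring
  have hk1 : Integrable k surfaceMeasure := hk.integrable one_le_two
  simp_rw [h1, columnAverage_eq hk1, Pi.smul_apply, smul_eq_mul]
  rw [← integral_const_mul, ← integral_const_mul]
  refine integral_congr_ae (ae_of_all _ fun x => ?_)
  have hl := two_mul_add_one_ne_zero ℓ
  field_simp

lemma conj_sphCoeff_of_real (hf : ∀ᵐ x ∂surfaceMeasure, conj (f x) = f x) (ℓ : ℕ) (m : Order ℓ) :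
    conj (sphCoeff f ℓ m) = ∫ x, f x * sphericalHarmonic ℓ m x ∂surfaceMeasure := by
  rw [sphCoeff, ← integral_conj]
  refine integral_congr_ae (hf.mono fun x hx => ?_)
  simp only [map_mul, hx, Complex.conj_conj]

lemma crossCorrelation_conj (hk : ∀ᵐ x ∂surfaceMeasure, conj (k x) = k x) (g : SO3) :
    crossCorrelation (fun x => conj (f x)) k g = conj (crossCorrelation f k g) := by
  rw [crossCorrelation, crossCorrelation, ← integral_conj]
  refine integral_congr_ae
    (((measurePreserving_rotate g⁻¹).quasiMeasurePreserving.ae hk).mono fun x hx => ?_)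
  simp only [map_mul, hx]

theorem smul_fourierSO3_wignerD (hf : MemLp f 2 surfaceMeasure) (hk : MemLp k 2 surfaceMeasure)
    (hreal : ∀ᵐ x ∂surfaceMeasure, conj (f x) = f x) (ℓ : ℕ) :
    ((2 * ℓ + 1 : ℕ) : ℂ) • fourierSO3 (crossCorrelation f k) (wignerD ℓ) =
      vecMulVec (sphCoeff k ℓ) (fun n => conj (sphCoeff f ℓ n)) := by
  ext i j
  have h := integral_crossCorrelation_mul_conj_wignerD hf hk ℓ j i
  rw [Matrix.smul_apply, fourierSO3, of_apply, vecMulVec_apply, smul_eq_mul,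
    conj_sphCoeff_of_real hreal, ← h]
  push_cast
  rfl

/-- For real-valued `k` this is the complex conjugate of the general formula, applied to the
conjugate of `f`. -/
theorem smul_fourierSO3_wignerDConj (hf : MemLp f 2 surfaceMeasure) (hk : MemLp k 2 surfaceMeasure)
    (hreal : ∀ᵐ x ∂surfaceMeasure, conj (k x) = k x) (ℓ : ℕ) :
    ((2 * ℓ + 1 : ℕ) : ℂ) • fourierSO3 (crossCorrelation f k) (wignerDConj ℓ) =
      vecMulVec (fun m => conj (sphCoeff k ℓ m)) (sphCoeff f ℓ) := by
  ext i j
  have h := congrArg conj (integral_crossCorrelation_mul_conj_wignerD hf.star hk ℓ j i)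
  simp only [map_mul, ← integral_conj, map_add, map_one, map_natCast, map_ofNat] at h
  rw [Matrix.smul_apply, fourierSO3, of_apply, vecMulVec_apply, smul_eq_mul]
  push_cast
  refine Eq.trans ?_ (h.trans ?_)
  · congr 2
    ext g
    have hg : conj (crossCorrelation (star f) k g) = crossCorrelation f k g :=
      (congrArg conj (crossCorrelation_conj hreal g)).trans (Complex.conj_conj _)
    rw [hg]
    rfl
  · congr 1
    simp [sphCoeff]

end Correlation

end SphericalCorrelation

theorem mainTheorem4 (f k : SphericalCorrelation.S2 → ℂ)
    (hf : MemLp f 2 SphericalCorrelation.surfaceMeasure)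
    (hk : MemLp k 2 SphericalCorrelation.surfaceMeasure) :
    (∀ g : SphericalCorrelation.SO3,
      Integrable (fun x => k (SphericalCorrelation.rotate g⁻¹ x) * f x)
        SphericalCorrelation.surfaceMeasure) ∧
    MemLp (SphericalCorrelation.crossCorrelation f k) 2 SphericalCorrelation.haarSO3 ∧
    ((∀ᵐ x ∂SphericalCorrelation.surfaceMeasure, conj (k x) = k x) → ∀ ℓ : ℕ,
      ((2 * ℓ + 1 : ℕ) : ℂ) • SphericalCorrelation.fourierSO3
          (SphericalCorrelation.crossCorrelation f k) (SphericalCorrelation.wignerDConj ℓ) =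
        Matrix.vecMulVec (fun m => conj (SphericalCorrelation.sphCoeff k ℓ m))
          (SphericalCorrelation.sphCoeff f ℓ)) ∧
    ((∀ᵐ x ∂SphericalCorrelation.surfaceMeasure, conj (f x) = f x) → ∀ ℓ : ℕ,
      ((2 * ℓ + 1 : ℕ) : ℂ) • SphericalCorrelation.fourierSO3
          (SphericalCorrelation.crossCorrelation f k) (SphericalCorrelation.wignerD ℓ) =
        Matrix.vecMulVec (SphericalCorrelation.sphCoeff k ℓ)
          (fun n => conj (SphericalCorrelation.sphCoeff f ℓ n))) := by
  exact ⟨SphericalCorrelation.integrable_correlation hf hk,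
    SphericalCorrelation.memLp_crossCorrelation hf hk,
    SphericalCorrelation.smul_fourierSO3_wignerDConj hf hk,
    SphericalCorrelation.smul_fourierSO3_wignerD hf hk⟩
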